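/- Let $m\ge 1$ parties $A_1,\dots,A_m$ and steps $l=1,\dots,L$ be given, and for each $l$ an ensemble $\mathcal E^l=\{\eta^l_i,\rho^l_i\}_{i=1}^{n_l}$ of density operators $\rho^l_i$ on $\bigotimes_{k=1}^m\mathbb C^{d^l_k}$ with probabilities $\eta^l_i>0$, $\sum_i\eta^l_i=1$. For $\vec c=(c_1,\dots,c_L)$ with $1\le c_l\le n_l$ put $\eta_{\vec c}=\prod_l\eta^l_{c_l}$ and $\rho_{\vec c}=\bigotimes_l\rho^l_{c_l}$, and let $\bigotimes_l\mathcal E^l=\{\eta_{\vec c},\rho_{\vec c}\}_{\vec c}$, an ensemble of $m$-party states in which party $A_k$ holds $\bigotimes_l\mathbb C^{d^l_k}$. A measurement is a finite family $\{M_i\}$ of positive semidefinite operators with $\sum_iM_i=\mathbb 1$. An operator is separable if it is a finite sum of tensor products over the parties of positive semidefinite operators; a measurement is separable if all its operators are, and LOCC if it is realized by a protocol of local operations and classical communication among $A_1,\dots,A_m$ with finitely many rounds. A Hermitian operator $E$ is block positive if $\operatorname{Tr}(E\sigma)\ge 0$ for every separable state $\sigma$. For an ensemble $\mathcal E=\{\eta_i,\rho_i\}_i$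 let $p_{\mathsf L}(\mathcal E)$ and $p_{\mathsf{SEP}}(\mathcal E)$ be the maximum of $\sum_i\eta_i\operatorname{Tr}(\rho_iM_i)$ over the LOCC, respectively separable, measurements $\{M_i\}_i$. Then the maxima $p_{\mathsf L}(\mathcal E^1),\dots,p_{\mathsf L}(\mathcal E^L)$, $p_{\mathsf L}(\bigotimes_l\mathcal E^l)$ and $p_{\mathsf{SEP}}(\bigotimes_l\mathcal E^l)$ are attained and satisfy $$\prod_{l=1}^Lp_{\mathsf L}(\mathcal E^l)=p_{\mathsf L}\Big(\bigotimes_{l=1}^L\mathcal E^l\Big)=p_{\mathsf{SEP}}\Big(\bigotimes_{l=1}^L\mathcal E^l\Big)$$ if and only if there exist LOCC measurements $\{M^1_i\}_{i=1}^{n_1},\dots,\{M^L_i\}_{i=1}^{n_L}$, where $\{M^l_i\}_i$ acts on $\bigotimes_k\mathbb C^{d^l_k}$, and a Hermitian operator $H$ such that, for every $\vec c$, the operator $H-\eta_{\vec c}\rho_{\vec c}$ is block positive and $$\operatorname{Tr}\big[M_{\vec c}\,(H-\eta_{\vec c}\rho_{\vec c})\big]=0,\qquad M_{\vec c}=M^1_{c_1}\otimes\cdots\otimes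 M^L_{c_L}.$$ -/

import Mathlib

open scoped Matrix ComplexOrder

namespace MultiParty

/-- The tensor product `⨂ₚ A p` of finitely many matrices. The space `⨂ₚ ℂ^(α p)` is indexed by
the functions choosing one basis index per factor. -/
def tensorOp {P : Type} [Fintype P] {α β : P → Type} (A : ∀ p, Matrix (α p) (β p) ℂ) :
    Matrix (∀ p, α p) (∀ p, β p) ℂ :=
  Matrix.of fun x y => ∏ p, A p (x p) (y p)

/-- Operators on the multi-party space `⨂ₚ ℂ^(ι p)`. -/
abbrev Op {P : Type} (ι : P → Type) : Type := Matrix (∀ p, ι p) (∀ p, ι p) ℂ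

section Basic

variable {P : Type} [Fintype P] [DecidableEq P] {o : Type} [Fintype o]

/-- An ensemble of states of a multi-party system: states `ρ i` prepared with nonzero
probabilities `η i`. -/
structure Ensemble (ι : P → Type) [∀ p, Fintype (ι p)] (o : Type) [Fintype o] where
  η : o → ℝ
  ρ : o → Op ι
  η_pos : ∀ i, 0 < η i
  η_sum : ∑ i, η i = 1
  ρ_psd : ∀ i, (ρ i).PosSemidef
  ρ_trace : ∀ i, (ρ i).trace = 1

/-- A measurement with outcomes in `o`. -/
def IsMeasurement {ι : P → Type} [∀ p, Fintype (ι p)] [∀ p, DecidableEq (ι p)]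
    (M : o → Op ι) : Prop :=
  (∀ i, (M i).PosSemidef) ∧ ∑ i, M i = 1

/-- A positive semidefinite operator is separable if it is a finite sum of tensor products, over
the parties, of positive semidefinite operators. -/
def IsSeparable {ι : P → Type} [∀ p, Fintype (ι p)] (E : Op ι) : Prop :=
  E.PosSemidef ∧ ∃ (r : ℕ) (F : Fin r → ∀ p, Matrix (ι p) (ι p) ℂ),
    (∀ s p, (F s p).PosSemidef) ∧ E = ∑ s, tensorOp (F s)

/-- A Hermitian operator is block positive if its mean value is nonnegative in every separable
state (the trace is real, both factors being Hermitian). -/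
def IsBlockPositive {ι : P → Type} [∀ p, Fintype (ι p)] (E : Op ι) : Prop :=
  E.IsHermitian ∧ ∀ σ : Op ι, IsSeparable σ → σ.trace = 1 → 0 ≤ (E * σ).trace.re

/-- A measurement all of whose operators are separable. -/
def IsSepMeasurement {ι : P → Type} [∀ p, Fintype (ι p)] [∀ p, DecidableEq (ι p)]
    (M : o → Op ι) : Prop :=
  IsMeasurement M ∧ ∀ i, IsSeparable (M i)

end Basic

/-- `RealizedByLOCC ι M`: the operators `M b`, `b : o`, are the effects of a protocol of local
operations and classical communication, with finitely many rounds, on the system `⨂ₚ ℂ^(ι p)`.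

* `announce`: the protocol stops, and the outcome `a` is announced.
* `round`: party `k` performs a local quantum instrument with Kraus operators `A j k`, where
  `∑ j, (A j k)ᴴ * A j k = 1`, and broadcasts the result `j`; then each other party `p` may apply
  a local isometry `A j p` that depends on `j` (the identity, the adjoining of an ancilla, ...).
  The output spaces `ℂ^(κ j p)` are arbitrary. The protocol continues with a protocol on them
  that may depend on `j`; its acting party may depend on `j` as well, so that the whole
  transcript is available to all parties at all times.

Discarding information, general local channels and shared randomness are covered: a party
performs an instrument whose result has no influence on the rest. Post-processing is
covered, since distinct branches may announce the same outcome. -/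
inductive RealizedByLOCC {P o : Type} [Fintype P] [DecidableEq P] [DecidableEq o] :
    ∀ (ι : P → Type) [∀ p, Fintype (ι p)] [∀ p, DecidableEq (ι p)], (o → Op ι) → Prop
  | announce (ι : P → Type) [∀ p, Fintype (ι p)] [∀ p, DecidableEq (ι p)] (a : o) :
      RealizedByLOCC ι (fun b => if b = a then 1 else 0)
  | round (ι : P → Type) [∀ p, Fintype (ι p)] [∀ p, DecidableEq (ι p)] (k : P) (r : ℕ)
      (κ : Fin r → P → Type) [∀ j p, Fintype (κ j p)] [∀ j p, DecidableEq (κ j p)]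
      (A : ∀ j p, Matrix (κ j p) (ι p) ℂ)
      (hk : ∑ j, (A j k)ᴴ * A j k = 1)
      (hp : ∀ j p, p ≠ k → (A j p)ᴴ * A j p = 1)
      (N : ∀ j, o → Op (κ j))
      (hN : ∀ j, RealizedByLOCC (κ j) (N j)) :
      RealizedByLOCC ι (fun b => ∑ j, (tensorOp (A j))ᴴ * N j b * tensorOp (A j))

section Discrimination

variable {P : Type} [Fintype P] [DecidableEq P] {o : Type} [Fintype o]

/-- A measurement that can be realized by LOCC. -/
def IsLOCCMeasurement [DecidableEq o] {ι : P → Type} [∀ p, Fintype (ι p)]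
    [∀ p, DecidableEq (ι p)] (M : o → Op ι) : Prop :=
  IsMeasurement M ∧ RealizedByLOCC ι M

/-- The average probability `∑ᵢ ηᵢ Tr(ρᵢ Mᵢ)` of correctly guessing the prepared state. -/
def Ensemble.success {ι : P → Type} [∀ p, Fintype (ι p)] (E : Ensemble ι o) (M : o → Op ι) : ℝ :=
  ∑ i, E.η i * (E.ρ i * M i).trace.re

/-- `p` is the maximum of the average success probability over the LOCC measurements. -/
def Ensemble.IsPL [DecidableEq o] {ι : P → Type} [∀ p, Fintype (ι p)] [∀ p, DecidableEq (ι p)]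
    (E : Ensemble ι o) (p : ℝ) : Prop :=
  IsGreatest {v | ∃ M : o → Op ι, IsLOCCMeasurement M ∧ E.success M = v} p

/-- `p` is the maximum of the average success probability over the separable measurements. -/
def Ensemble.IsPSEP {ι : P → Type} [∀ p, Fintype (ι p)] [∀ p, DecidableEq (ι p)]
    (E : Ensemble ι o) (p : ℝ) : Prop :=
  IsGreatest {v | ∃ M : o → Op ι, IsSepMeasurement M ∧ E.success M = v} p

end Discrimination

section Sequence

variable {P S : Type} [Fintype S]

/-- The tensor product, over the steps `l : S`, of operators on the multi-party spaces
`⨂ₚ ℂ^(ι l p)`. The result is regarded as an operator on the multi-party space in which party `p`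
holds `⨂ₗ ℂ^(ι l p)`, its shares of all the steps. -/
def stepTensor {ι : S → P → Type} (A : ∀ l, Op (ι l)) : Op (fun p => ∀ l, ι l p) :=
  (tensorOp A).submatrix (fun x l p => x p l) (fun x l p => x p l)

theorem tensorOp_posSemidef [DecidableEq S] {α : S → Type} [∀ l, Fintype (α l)]
    (A : ∀ l, Matrix (α l) (α l) ℂ) (hA : ∀ l, (A l).PosSemidef) :
    (tensorOp A).PosSemidef := by
  classical
  have h : ∀ l, ∃ B : Matrix (α l) (α l) ℂ, A l = Bᴴ * B := fun l => by
    open scoped MatrixOrder in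
    obtain ⟨B, hB⟩ := CStarAlgebra.nonneg_iff_eq_star_mul_self.mp (hA l).nonneg
    exact ⟨B, hB⟩
  choose B hB using h
  have : tensorOp A = (tensorOp B)ᴴ * tensorOp B := by
    ext x y
    simp only [tensorOp, Matrix.of_apply, Matrix.mul_apply, Matrix.conjTranspose_apply, hB]
    rw [Fintype.prod_sum]
    refine Finset.sum_congr rfl fun z _ => ?_
    rw [star_prod, Finset.prod_mul_distrib]
  rw [this]
  exact Matrix.posSemidef_conjTranspose_mul_self _

theorem stepTensor_posSemidef [Fintype P] [DecidableEq P] [DecidableEq S] {ι : S → P → Type} [∀ l p, Fintype (ι l p)]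
    (A : ∀ l, Op (ι l)) (hA : ∀ l, (A l).PosSemidef) : (stepTensor A).PosSemidef := by
  classical
  exact (tensorOp_posSemidef A hA).submatrix _

theorem stepTensor_trace [Fintype P] [DecidableEq P] [DecidableEq S] {ι : S → P → Type}
    [∀ l p, Fintype (ι l p)] (A : ∀ l, Op (ι l)) :
    (stepTensor A).trace = ∏ l, (A l).trace := by
  simp only [Matrix.trace, Matrix.diag]
  rw [Fintype.prod_sum]
  exact Fintype.sum_equiv (Equiv.piComm fun p l => ι l p) _ _ fun x => rfl

/-- The sequence ensemble `⨂ₗ E l`: for `c = (c l)ₗ`, the state `⨂ₗ ρˡ_(c l)` is prepared with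
probability `∏ₗ ηˡ_(c l)`. -/
def seqEnsemble [Fintype P] [DecidableEq P] [DecidableEq S] {ι : S → P → Type}
    [∀ l p, Fintype (ι l p)] {o : S → Type} [∀ l, Fintype (o l)]
    (E : ∀ l, Ensemble (ι l) (o l)) : Ensemble (fun p => ∀ l, ι l p) (∀ l, o l) where
  η c := ∏ l, (E l).η (c l)
  ρ c := stepTensor fun l => (E l).ρ (c l)
  η_pos c := Finset.prod_pos fun l _ => (E l).η_pos (c l)
  η_sum := by
    rw [← Fintype.prod_sum]
    exact Finset.prod_eq_one fun l _ => (E l).η_sum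
  ρ_psd c := stepTensor_posSemidef _ fun l => (E l).ρ_psd (c l)
  ρ_trace c := by
    rw [stepTensor_trace]
    exact Finset.prod_eq_one fun l _ => (E l).ρ_trace (c l)

end Sequence

end MultiParty

/-! The theorem is conic duality for separable discrimination. The primal maximizes the success
probability over separable measurements; the dual minimizes `Tr H` subject to block positivity of
every `H - η ρ`. Since the effects of a measurement sum to `1`, the gap between dual and primal
values is a sum of terms `Tr[(H - η ρ) M]`, each nonnegative when `M` is separable; the trace
condition of the theorem is complementary slackness. If the three values agree,
`Ensemble.IsPSEP.exists_dual` gives `H` with trace `p_SEP`, and the product of optimal step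
measurements attains this value, so the gap vanishes term by term. Conversely, the trace condition
closes the gap for the product measurement, which is LOCC (`RealizedByLOCC.stepTensor`), hence
separable. Thus `Tr H` is both maxima for the sequence and equals the product of the step values.
Exchanging the measurement of one step cannot raise this positive product, so every step measurement
is optimal. -/

namespace MultiParty

/-! ### Algebra of tensor products of local operators -/

section TensorOp

variable {P : Type} [Fintype P]

theorem tensorOp_conjTranspose {α β : P → Type} (A : ∀ p, Matrix (α p) (β p) ℂ) :
    (tensorOp A)ᴴ = tensorOp fun p => (A p)ᴴ := by
  ext x y
  simp [tensorOp, Matrix.conjTranspose_apply, star_prod]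

theorem tensorOp_mul [DecidableEq P] {α β γ : P → Type} [∀ p, Fintype (β p)]
    (A : ∀ p, Matrix (α p) (β p) ℂ) (B : ∀ p, Matrix (β p) (γ p) ℂ) :
    tensorOp A * tensorOp B = tensorOp fun p => A p * B p := by
  ext x y
  simp only [tensorOp, Matrix.of_apply, Matrix.mul_apply]
  rw [Fintype.prod_sum]
  exact Finset.sum_congr rfl fun z _ => Finset.prod_mul_distrib.symm

theorem tensorOp_one {α : P → Type} [∀ p, DecidableEq (α p)] :
    tensorOp (fun p => (1 : Matrix (α p) (α p) ℂ)) = 1 := by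
  ext x y
  simp only [tensorOp, Matrix.of_apply, Matrix.one_apply, funext_iff]
  rw [Fintype.prod_ite_zero, Finset.prod_const_one]

theorem tensorOp_isometry [DecidableEq P] {α β : P → Type} [∀ p, Fintype (α p)]
    [∀ p, DecidableEq (β p)] {V : ∀ p, Matrix (α p) (β p) ℂ} (hV : ∀ p, (V p)ᴴ * V p = 1) :
    (tensorOp V)ᴴ * tensorOp V = 1 := by
  rw [tensorOp_conjTranspose, tensorOp_mul, ← tensorOp_one]
  exact congrArg _ (funext hV)

end TensorOp

/-! ### Two systems shared by the same parties -/

section PartyKron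

variable {P : Type}

/-- The equivalence between joint indices of two systems shared by the same parties and pairs of
indices. -/
def splitEquiv (α β : P → Type) : (∀ p, α p × β p) ≃ (∀ p, α p) × (∀ p, β p) where
  toFun x := (fun p => (x p).1, fun p => (x p).2)
  invFun z p := (z.1 p, z.2 p)
  left_inv _ := rfl
  right_inv _ := rfl

/-- The tensor product of operators on two multi-party systems, regarded as an operator on the
system in which each party holds its shares of both. -/
def partyKron {α β γ δ : P → Type} (A : Matrix (∀ p, α p) (∀ p, β p) ℂ)
    (B : Matrix (∀ p, γ p) (∀ p, δ p) ℂ) : Matrix (∀ p, α p × γ p) (∀ p, β p × δ p) ℂ :=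
  (Matrix.kronecker A B).submatrix (splitEquiv α γ) (splitEquiv β δ)

theorem partyKron_apply {α β γ δ : P → Type} (A : Matrix (∀ p, α p) (∀ p, β p) ℂ)
    (B : Matrix (∀ p, γ p) (∀ p, δ p) ℂ) (x : ∀ p, α p × γ p) (y : ∀ p, β p × δ p) :
    partyKron A B x y =
      A (fun p => (x p).1) (fun p => (y p).1) * B (fun p => (x p).2) (fun p => (y p).2) := rfl

theorem partyKron_mul [Fintype P] [DecidableEq P] {α β γ α' β' γ' : P → Type} [∀ p, Fintype (β p)]
    [∀ p, Fintype (β' p)] (A : Matrix (∀ p, α p) (∀ p, β p) ℂ)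
    (A' : Matrix (∀ p, α' p) (∀ p, β' p) ℂ) (B : Matrix (∀ p, β p) (∀ p, γ p) ℂ)
    (B' : Matrix (∀ p, β' p) (∀ p, γ' p) ℂ) :
    partyKron A A' * partyKron B B' = partyKron (A * B) (A' * B') := by
  unfold partyKron Matrix.kronecker
  rw [Matrix.submatrix_mul_equiv, Matrix.mul_kronecker_mul]

theorem partyKron_conjTranspose {α β γ δ : P → Type} (A : Matrix (∀ p, α p) (∀ p, β p) ℂ)
    (B : Matrix (∀ p, γ p) (∀ p, δ p) ℂ) : (partyKron A B)ᴴ = partyKron Aᴴ Bᴴ := by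
  ext x y
  simp [partyKron_apply, Matrix.conjTranspose_apply]

theorem partyKron_one [Fintype P] {α γ : P → Type} [∀ p, DecidableEq (α p)] [∀ p, DecidableEq (γ p)] :
    partyKron (1 : Op α) (1 : Op γ) = 1 := by
  ext x y
  simp only [partyKron_apply, Matrix.one_apply, funext_iff, Prod.ext_iff, forall_and,
    ← ite_and, mul_ite, mul_one, mul_zero]
  simp only [and_comm]

theorem partyKron_zero_left {α β γ δ : P → Type} (B : Matrix (∀ p, γ p) (∀ p, δ p) ℂ) :
    partyKron (0 : Matrix (∀ p, α p) (∀ p, β p) ℂ) B = 0 := by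
  ext x y
  simp [partyKron_apply]

theorem partyKron_zero_right {α β γ δ : P → Type} (A : Matrix (∀ p, α p) (∀ p, β p) ℂ) :
    partyKron A (0 : Matrix (∀ p, γ p) (∀ p, δ p) ℂ) = 0 := by
  ext x y
  simp [partyKron_apply]

theorem partyKron_sum_left {α β γ δ : P → Type} {s : Type} [Fintype s]
    (A : s → Matrix (∀ p, α p) (∀ p, β p) ℂ) (B : Matrix (∀ p, γ p) (∀ p, δ p) ℂ) :
    partyKron (∑ i, A i) B = ∑ i, partyKron (A i) B := by
  ext x y
  simp [partyKron_apply, Matrix.sum_apply, Finset.sum_mul]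

theorem partyKron_sum_right {α β γ δ : P → Type} {s : Type} [Fintype s]
    (A : Matrix (∀ p, α p) (∀ p, β p) ℂ) (B : s → Matrix (∀ p, γ p) (∀ p, δ p) ℂ) :
    partyKron A (∑ i, B i) = ∑ i, partyKron A (B i) := by
  ext x y
  simp [partyKron_apply, Matrix.sum_apply, Finset.mul_sum]

theorem tensorOp_kronecker [Fintype P] {α β γ δ : P → Type} (A : ∀ p, Matrix (α p) (β p) ℂ)
    (B : ∀ p, Matrix (γ p) (δ p) ℂ) :
    tensorOp (fun p => Matrix.kronecker (A p) (B p)) = partyKron (tensorOp A) (tensorOp B) := by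
  ext x y
  simp [partyKron_apply, tensorOp, Finset.prod_mul_distrib]

theorem kronecker_conjTranspose_mul_self {a b c d : Type} [Fintype a] [Fintype c]
    (A : Matrix a b ℂ) (B : Matrix c d ℂ) :
    (Matrix.kronecker A B)ᴴ * Matrix.kronecker A B = Matrix.kronecker (Aᴴ * A) (Bᴴ * B) := by
  unfold Matrix.kronecker
  rw [Matrix.conjTranspose_kronecker, Matrix.mul_kronecker_mul]

theorem kronecker_sum_left {a b c d s : Type} [Fintype s] (A : s → Matrix a b ℂ)
    (B : Matrix c d ℂ) :
    ∑ j, Matrix.kronecker (A j) B = Matrix.kronecker (∑ j, A j) B := by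
  ext x y
  simp [Matrix.sum_apply, Finset.sum_mul]

theorem kronecker_sum_right {a b c d s : Type} [Fintype s] (A : Matrix a b ℂ)
    (B : s → Matrix c d ℂ) :
    ∑ j, Matrix.kronecker A (B j) = Matrix.kronecker A (∑ j, B j) := by
  ext x y
  simp [Matrix.sum_apply, Finset.mul_sum]

end PartyKron

/-! ### Composition of LOCC protocols -/

namespace RealizedByLOCC

variable {P o o' : Type} [Fintype P] [DecidableEq P] [DecidableEq o] [DecidableEq o']
  {ι κ : P → Type} [∀ p, Fintype (ι p)] [∀ p, DecidableEq (ι p)]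
  [∀ p, Fintype (κ p)] [∀ p, DecidableEq (κ p)]

theorem announce_of_eq {M : o → Op ι} (a : o) (hM : ∀ b, M b = if b = a then 1 else 0) :
    RealizedByLOCC ι M := by
  rw [funext hM]
  exact announce ι a

theorem round_of_eq {M : o → Op ι} (k : P) {r : ℕ} {κ : Fin r → P → Type}
    [∀ j p, Fintype (κ j p)] [∀ j p, DecidableEq (κ j p)] (A : ∀ j p, Matrix (κ j p) (ι p) ℂ)
    (hk : ∑ j, (A j k)ᴴ * A j k = 1) (hp : ∀ j p, p ≠ k → (A j p)ᴴ * A j p = 1)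
    {N : ∀ j, o → Op (κ j)} (hN : ∀ j, RealizedByLOCC (κ j) (N j))
    (hM : ∀ b, M b = ∑ j, (tensorOp (A j))ᴴ * N j b * tensorOp (A j)) :
    RealizedByLOCC ι M := by
  rw [funext hM]
  exact round ι k r κ A hk hp N hN

/-- Local isometries may precede an LOCC protocol. -/
theorem isometry {N : o → Op κ} (hN : RealizedByLOCC κ N) (V : ∀ p, Matrix (κ p) (ι p) ℂ)
    (hV : ∀ p, (V p)ᴴ * V p = 1) :
    RealizedByLOCC ι fun b => (tensorOp V)ᴴ * N b * tensorOp V := by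
  cases hN with
  | announce _ a =>
    refine announce_of_eq a fun b => ?_
    dsimp only
    split_ifs
    · rw [Matrix.mul_one, tensorOp_isometry hV]
    · simp
  | round _ k r κ' A hk hp N hN =>
    -- The isometries are absorbed into the Kraus operators and isometries of the first round.
    refine round_of_eq k (fun j p => A j p * V p) ?_ (fun j p h => ?_) hN fun b => ?_
    · simp_rw [Matrix.conjTranspose_mul, Matrix.mul_assoc, ← Matrix.mul_assoc (A _ k)ᴴ,
        ← Matrix.mul_sum, ← Matrix.sum_mul, hk, Matrix.one_mul, hV]
    · rw [Matrix.conjTranspose_mul, Matrix.mul_assoc, ← Matrix.mul_assoc (A j p)ᴴ, hp j p h,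
        Matrix.one_mul, hV]
    · simp_rw [← tensorOp_mul, Matrix.conjTranspose_mul, Matrix.mul_sum, Matrix.sum_mul,
        Matrix.mul_assoc]

/-- The basis indices of the local spaces may be renamed. -/
theorem reindex {N : o → Op κ} (hN : RealizedByLOCC κ N) (e : ∀ p, ι p ≃ κ p) :
    RealizedByLOCC ι fun b =>
      (N b).submatrix (Equiv.piCongrRight e) (Equiv.piCongrRight e) := by
  -- Renaming is conjugation by local permutation matrices, which are isometries.
  have hV : tensorOp (fun p => (1 : Matrix (κ p) (κ p) ℂ).submatrix id (e p)) =
      (1 : Op κ).submatrix id (Equiv.piCongrRight e) := by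
    rw [← tensorOp_one]
    rfl
  convert hN.isometry (fun p => (1 : Matrix (κ p) (κ p) ℂ).submatrix id (e p)) fun p => ?_ using 2
  · rw [hV, Matrix.conjTranspose_submatrix, Matrix.conjTranspose_one]
    ext x y
    simp [Matrix.mul_apply, Matrix.one_apply]
  · ext x y
    simp [Matrix.mul_apply, Matrix.one_apply, eq_comm]

/-- The outcome of an LOCC protocol may be relabelled. -/
theorem relabel [Fintype o] {M : o → Op ι} (hM : RealizedByLOCC ι M) (f : o → o') :
    RealizedByLOCC ι fun b => ∑ a, if f a = b then M a else 0 := by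
  induction hM with
  | announce ι a =>
    refine announce_of_eq (f a) fun b => ?_
    rw [Finset.sum_eq_single a (fun a' _ h => by simp [h]) (by simp)]
    simp [eq_comm]
  | round ι k r κ A hk hp N hN ih =>
    refine round_of_eq k A hk hp ih fun b => ?_
    simp_rw [Matrix.mul_sum, Matrix.sum_mul]
    rw [Finset.sum_comm]
    refine Finset.sum_congr rfl fun a _ => ?_
    split_ifs <;> simp

/-- The parties may run an LOCC protocol on the second of two shared systems. -/
theorem partyKron_one_left {Q : o → Op κ} (hQ : RealizedByLOCC κ Q) :
    RealizedByLOCC (fun p => ι p × κ p) fun b => partyKron (1 : Op ι) (Q b) := by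
  induction hQ with
  | announce κ a =>
    refine announce_of_eq a fun b => ?_
    dsimp only
    split_ifs
    · exact partyKron_one (α := ι) (γ := κ)
    · exact partyKron_zero_right _
  | round κ k r κ' A hk hp N hN ih =>
    refine round_of_eq k (κ := fun j p => ι p × κ' j p)
      (fun j p => Matrix.kronecker (1 : Matrix (ι p) (ι p) ℂ) (A j p))
      ?_ (fun j p h => ?_) ih fun b => ?_
    · simp_rw [kronecker_conjTranspose_mul_self]
      rw [kronecker_sum_right, hk]
      simp [Matrix.kronecker]
    · rw [kronecker_conjTranspose_mul_self, hp j p h]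
      simp [Matrix.kronecker]
    · simp_rw [tensorOp_kronecker, partyKron_conjTranspose, partyKron_mul, tensorOp_one,
        Matrix.conjTranspose_one, Matrix.mul_one, partyKron_sum_right]

/-- After an LOCC protocol on the first of two shared systems, the parties may run an LOCC
protocol on the second one that depends on the outcome. -/
theorem adaptive [Fintype o] {N : o → Op ι} (hN : RealizedByLOCC ι N) {Q : o → o' → Op κ}
    (hQ : ∀ a, RealizedByLOCC κ (Q a)) :
    RealizedByLOCC (fun p => ι p × κ p) fun b => ∑ a, partyKron (N a) (Q a b) := by
  induction hN with
  | announce ι a =>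
    -- Once `a` is announced, only the term of `Q a` survives, and the first system stays idle.
    convert (hQ a).partyKron_one_left (ι := ι) using 2 with b
    rw [Finset.sum_eq_single a (fun a' _ h => by simp [h, partyKron_zero_left]) (by simp)]
    simp
  | round ι k r κ' A hk hp N hN ih =>
    refine round_of_eq k (κ := fun j p => κ' j p × κ p)
      (fun j p => Matrix.kronecker (A j p) (1 : Matrix (κ p) (κ p) ℂ))
      ?_ (fun j p h => ?_) ih fun b => ?_
    · simp_rw [kronecker_conjTranspose_mul_self]
      rw [kronecker_sum_left, hk]
      simp [Matrix.kronecker]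
    · rw [kronecker_conjTranspose_mul_self, hp j p h]
      simp [Matrix.kronecker]
    · simp_rw [tensorOp_kronecker, partyKron_conjTranspose, Matrix.mul_sum, Matrix.sum_mul,
        partyKron_mul, tensorOp_one, Matrix.conjTranspose_one, Matrix.mul_one, Matrix.one_mul,
        partyKron_sum_left]
      exact Finset.sum_comm

/-- LOCC protocols for the steps of a sequence, run one after the other, form an LOCC protocol for
the sequence. -/
theorem stepTensor {L : ℕ} {ι : Fin L → P → Type} [∀ l p, Fintype (ι l p)]
    [∀ l p, DecidableEq (ι l p)] {o : Fin L → Type} [∀ l, Fintype (o l)] [∀ l, DecidableEq (o l)]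
    {M : ∀ l, o l → Op (ι l)} (hM : ∀ l, RealizedByLOCC (ι l) (M l)) :
    RealizedByLOCC (fun p => ∀ l, ι l p)
      fun c : ∀ l, o l => MultiParty.stepTensor fun l => M l (c l) := by
  induction L with
  | zero =>
    refine announce_of_eq (fun l => l.elim0) fun c => ?_
    rw [if_pos (Subsingleton.elim _ _)]
    ext x y
    rw [Subsingleton.elim x y, Matrix.one_apply_eq]
    simp [MultiParty.stepTensor, tensorOp]
  | succ L ih =>
    have tail := ih (fun l => hM l.succ)
    -- The steps do not depend on each other; adaptivity serves only to record the outcome `a` in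
    -- the final label.
    have pair := (hM 0).adaptive fun a => tail.relabel (fun c' => (Fin.cons a c' : ∀ l, o l))
    convert pair.reindex (fun p => (Fin.consEquiv fun l => ι l p).symm) using 2 with c
    rw [Finset.sum_eq_single (M := Op fun p => ι 0 p × ∀ l : Fin L, ι l.succ p) (c 0)]
    · rw [Finset.sum_eq_single (Fin.tail c)]
      · rw [if_pos (Fin.cons_self_tail c)]
        ext x y
        simp only [MultiParty.stepTensor, tensorOp, Matrix.submatrix_apply, Matrix.of_apply,
          Fin.prod_univ_succ, partyKron_apply]
        rfl
      · intro c' _ hc'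
        rw [if_neg]
        intro h
        rw [← h] at hc'
        exact hc' (Fin.tail_cons _ _).symm
      · simp
    · intro a _ ha
      rw [Finset.sum_eq_zero, partyKron_zero_right]
      intro c' _
      rw [if_neg]
      rintro rfl
      exact ha (by simp)
    · simp

end RealizedByLOCC
-- Conic duality by the M. Riesz extension theorem
/-- Duality for the maximization of `∑ c, φ c (M c)` over the families `M` in a convex cone with
`∑ c, M c = e`, where `e` is an order unit of the cone: the optimal value is attained by a
dual-feasible functional. -/
theorem exists_dual_functional {V o : Type} [AddCommGroup V] [Module ℝ V] [Fintype o] [Nonempty o]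
    (C : PointedCone ℝ V) {e : V} (he : ∀ x ∈ C, ∃ t : ℝ, t • e - x ∈ C) (heC : e ∈ C)
    (φ : o → V →ₗ[ℝ] ℝ) {s : ℝ} (τ : V →ₗ[ℝ] ℝ) (hτ : τ e = s)
    (hs : ∀ (a : ℝ) (M : o → V), (∀ c, M c ∈ C) → ∑ c, M c = a • e → ∑ c, φ c (M c) ≤ a * s) :
    ∃ h : V →ₗ[ℝ] ℝ, h e = s ∧ ∀ c, ∀ x ∈ C, φ c x ≤ h x := by
  classical
  have smul_mem : ∀ {t : ℝ} {x : V}, 0 ≤ t → x ∈ C → t • x ∈ C := fun {t x} ht hx =>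
    C.smul_mem ht hx
  -- The extension theorem needs every vector to be moved into the cone by the initial domain. On
  -- the span of `C` the order unit does this.
  let W : Submodule ℝ V := Submodule.span ℝ (C : Set V)
  have hWC : ∀ x ∈ C, x ∈ W := fun x hx => Submodule.subset_span hx
  have hW : ∀ x ∈ W, (∃ t : ℝ, t • e + x ∈ C) ∧ ∃ t : ℝ, t • e - x ∈ C := by
    intro x hx
    induction hx using Submodule.span_induction with
    | mem x hx => exact ⟨⟨0, by simpa using hx⟩, he x hx⟩
    | zero => exact ⟨⟨0, by simp⟩, ⟨0, by simp⟩⟩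
    | add x y _ _ ihx ihy =>
      obtain ⟨⟨a, ha⟩, b, hb⟩ := ihx
      obtain ⟨⟨a', ha'⟩, b', hb'⟩ := ihy
      refine ⟨⟨a + a', ?_⟩, b + b', ?_⟩
      · convert C.add_mem ha ha' using 1
        module
      · convert C.add_mem hb hb' using 1
        module
    | smul r x _ ih =>
      obtain ⟨⟨a, ha⟩, b, hb⟩ := ih
      rcases le_total 0 r with hr | hr
      · refine ⟨⟨r * a, ?_⟩, r * b, ?_⟩
        · convert smul_mem hr ha using 1
          module
        · convert smul_mem hr hb using 1
          module
      · refine ⟨⟨-r * b, ?_⟩, -r * a, ?_⟩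
        · convert smul_mem (neg_nonneg.2 hr) hb using 1
          module
        · convert smul_mem (neg_nonneg.2 hr) ha using 1
          module
  -- The hypograph of the optimal value as a function of the prescribed sum `∑ c, M c`.
  let K : PointedCone ℝ (W × ℝ) :=
    { carrier := {z | ∃ M : o → V, (∀ c, M c ∈ C) ∧ (z.1 : V) = ∑ c, M c ∧
        z.2 ≤ ∑ c, φ c (M c)}
      zero_mem' := ⟨0, fun _ => C.zero_mem, by simp, by simp⟩
      add_mem' := by
        rintro z z' ⟨M, hM, h1, h2⟩ ⟨M', hM', h1', h2'⟩
        refine ⟨M + M', fun c => C.add_mem (hM c) (hM' c), ?_, ?_⟩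
        · simp only [Prod.fst_add, Submodule.coe_add, h1, h1', Pi.add_apply,
            Finset.sum_add_distrib]
        · simpa [Finset.sum_add_distrib] using add_le_add h2 h2'
      smul_mem' := by
        rintro ⟨t, ht⟩ z ⟨M, hM, h1, h2⟩
        refine ⟨fun c => t • M c, fun c => smul_mem ht (hM c), ?_, ?_⟩
        · change t • (z.1 : V) = _
          rw [h1, Finset.smul_sum]
        · change t * z.2 ≤ _
          simpa [Finset.mul_sum] using mul_le_mul_of_nonneg_left h2 ht }
  have single_mem : ∀ (c : o) (x : V) (hx : x ∈ C), ((⟨x, hWC x hx⟩, φ c x) : W × ℝ) ∈ K := by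
    intro c x hx
    refine ⟨Pi.single c x, fun c' => ?_, ?_, ?_⟩
    · rcases eq_or_ne c' c with rfl | h
      · simpa using hx
      · simp [h]
    · simp
    · rw [Finset.sum_eq_single c (fun c' _ h => by simp [h]) (by simp)]
      simp
  let eW : W := ⟨e, hWC e heC⟩
  -- On `D` this is `(a • e, t) ↦ a * s - t`, nonnegative on `K` by `hs`. The functional `τ` makes
  -- it well defined without assuming `e ≠ 0`.
  let F : W × ℝ →ₗ[ℝ] ℝ := (τ ∘ₗ W.subtype) ∘ₗ LinearMap.fst ℝ W ℝ - LinearMap.snd ℝ W ℝ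
  have hF : ∀ z : W × ℝ, F z = τ z.1 - z.2 := fun z => rfl
  let D : Submodule ℝ (W × ℝ) := (Submodule.span ℝ {eW}).prod ⊤
  have hD : ∀ a t : ℝ, ((a • eW, t) : W × ℝ) ∈ D := fun a t =>
    ⟨Submodule.smul_mem _ _ (Submodule.mem_span_singleton_self _), trivial⟩
  obtain ⟨g, hg, hgK⟩ := riesz_extension K ⟨D, F.domRestrict D⟩ (by
      rintro ⟨⟨x, t⟩, hx, -⟩
      obtain ⟨a, rfl⟩ := Submodule.mem_span_singleton.1 hx
      rintro ⟨M, hM, h1, h2⟩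
      have := hs a M hM h1.symm
      change 0 ≤ F _
      rw [hF]
      change 0 ≤ τ (a • e) - t
      rw [map_smul, hτ, smul_eq_mul]
      exact sub_nonneg.2 (le_trans h2 this)) (by
      rintro ⟨x, t⟩
      obtain ⟨a, ha⟩ := (hW x x.2).1
      obtain ⟨c⟩ := ‹Nonempty o›
      refine ⟨⟨(a • eW, φ c (a • e + x) - t), hD _ _⟩, ?_⟩
      convert single_mem c _ ha using 1
      ext
      · rfl
      · simp)
  have hg' : ∀ a t : ℝ, g (a • eW, t) = a * s - t := fun a t => by
    rw [hg ⟨_, hD a t⟩]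
    change F _ = _
    rw [hF]
    change τ (a • e) - t = _
    rw [map_smul, hτ, smul_eq_mul]
  obtain ⟨h, hh⟩ := LinearMap.exists_extend (g ∘ₗ LinearMap.inl ℝ W ℝ)
  have hh' : ∀ x (hx : x ∈ W), h x = g (⟨x, hx⟩, 0) := fun x hx =>
    LinearMap.congr_fun hh ⟨x, hx⟩
  refine ⟨h, ?_, fun c x hx => ?_⟩
  · rw [hh' e (hWC e heC)]
    simpa using hg' 1 0
  -- As `g (0, t) = -t`, nonnegativity of `g` at `(x, φ c x)` is the dual constraint.
  · have h1 := hgK _ (single_mem c x hx)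
    have h2 : ((⟨x, hWC x hx⟩, φ c x) : W × ℝ) = (⟨x, hWC x hx⟩, 0) + ((0 : ℝ) • eW, φ c x) := by
      simp
    rw [h2, map_add, hg', ← hh'] at h1
    linarith

/-- Every real-linear functional on complex matrices has the form `X ↦ Re Tr(H X)` on Hermitian
matrices, with a Hermitian `H`. -/
theorem exists_isHermitian_re_trace {a : Type} [Fintype a] [DecidableEq a]
    (h : Matrix a a ℂ →ₗ[ℝ] ℝ) :
    ∃ H : Matrix a a ℂ, H.IsHermitian ∧ ∀ X, X.IsHermitian → h X = (H * X).trace.re := by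
  -- The signs come from `Re (G j i * X i j)`, in which the imaginary parts enter with a minus.
  let G : Matrix a a ℂ :=
    Matrix.of fun j i => ⟨h (Matrix.single i j 1), -h (Matrix.single i j Complex.I)⟩
  have hG : ∀ X, h X = (G * X).trace.re := by
    intro X
    have hX : X = ∑ i, ∑ j, ((X i j).re • Matrix.single i j (1 : ℂ) +
        (X i j).im • Matrix.single i j Complex.I) := by
      conv_lhs => rw [Matrix.matrix_eq_sum_single X]
      refine Finset.sum_congr rfl fun i _ => Finset.sum_congr rfl fun j _ => ?_
      rw [Matrix.smul_single, Matrix.smul_single, ← Matrix.single_add]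
      congr 1
      apply Complex.ext <;> simp
    conv_lhs => rw [hX]
    simp only [map_sum, map_add, map_smul, Matrix.trace, Matrix.diag, Matrix.mul_apply,
      Complex.re_sum, Complex.mul_re, G, Matrix.of_apply, smul_eq_mul]
    rw [Finset.sum_comm]
    refine Finset.sum_congr rfl fun i _ => Finset.sum_congr rfl fun j _ => ?_
    ring
  -- The anti-Hermitian part of `G` has purely imaginary trace against a Hermitian `X`.
  refine ⟨(2⁻¹ : ℝ) • (G + Gᴴ), ?_, fun X hX => ?_⟩
  · rw [Matrix.IsHermitian, Matrix.conjTranspose_smul, Matrix.conjTranspose_add,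
      Matrix.conjTranspose_conjTranspose, add_comm, star_trivial]
  · have h1 : (Gᴴ * X).trace.re = (G * X).trace.re := by
      rw [← hX.eq, ← Matrix.conjTranspose_mul, Matrix.trace_conjTranspose, hX.eq,
        Matrix.trace_mul_comm]
      simp
    rw [hG, Matrix.smul_mul, Matrix.trace_smul, Matrix.add_mul, Matrix.trace_add,
      Complex.smul_re, Complex.add_re, h1, smul_eq_mul]
    ring

open scoped MatrixOrder Matrix.Norms.L2Operator in
theorem posSemidef_smul_one_sub {a : Type} [Fintype a] [DecidableEq a] {X : Matrix a a ℂ}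
    (hX : X.PosSemidef) : ∃ t : ℝ, (t • (1 : Matrix a a ℂ) - X).PosSemidef := by
  refine ⟨‖X‖, ?_⟩
  have := IsSelfAdjoint.le_algebraMap_norm_self (a := X) hX.isHermitian
  rwa [Matrix.le_iff, Algebra.algebraMap_eq_smul_one] at this

/-! ### The cone of separable operators -/

section Separable

variable {P : Type} [Fintype P] [DecidableEq P] {ι : P → Type} [∀ p, Fintype (ι p)]

theorem isSeparable_sum_tensorOp {s : Type} [Fintype s] (F : s → ∀ p, Matrix (ι p) (ι p) ℂ)
    (hF : ∀ i p, (F i p).PosSemidef) : IsSeparable (∑ i, tensorOp (F i)) := by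
  refine ⟨Matrix.posSemidef_sum _ fun i _ => tensorOp_posSemidef _ (hF i), Fintype.card s,
    fun j => F ((Fintype.equivFin s).symm j), fun j p => hF _ p, ?_⟩
  exact (Equiv.sum_comp (Fintype.equivFin s).symm fun i => tensorOp (F i)).symm

theorem isSeparable_tensorOp (F : ∀ p, Matrix (ι p) (ι p) ℂ) (hF : ∀ p, (F p).PosSemidef) :
    IsSeparable (tensorOp F) := by
  simpa using isSeparable_sum_tensorOp (fun _ : Unit => F) fun _ => hF

theorem isSeparable_zero : IsSeparable (0 : Op ι) := by
  simpa using isSeparable_sum_tensorOp (ι := ι) (fun i : Empty => i.elim) fun i => i.elim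

theorem isSeparable_one [∀ p, DecidableEq (ι p)] : IsSeparable (1 : Op ι) := by
  rw [← tensorOp_one]
  exact isSeparable_tensorOp _ fun _ => Matrix.PosSemidef.one

theorem IsSeparable.add {E E' : Op ι} (hE : IsSeparable E) (hE' : IsSeparable E') :
    IsSeparable (E + E') := by
  obtain ⟨-, r, F, hF, rfl⟩ := hE
  obtain ⟨-, r', F', hF', rfl⟩ := hE'
  have := isSeparable_sum_tensorOp (Sum.elim F F') fun i p => by
    rcases i with i | i
    · exact hF i p
    · exact hF' i p
  simpa using this

theorem IsSeparable.sum {s : Type} [Fintype s] {E : s → Op ι} (hE : ∀ i, IsSeparable (E i)) :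
    IsSeparable (∑ i, E i) :=
  Finset.sum_induction E IsSeparable (fun _ _ => IsSeparable.add) isSeparable_zero fun i _ => hE i

/-- The scalar is absorbed by the factor of one party, so a party must exist: with none, every
tensor product is `1` and the sums are only natural multiples of it. -/
theorem IsSeparable.smul [Nonempty P] {E : Op ι} (hE : IsSeparable E) {t : ℝ} (ht : 0 ≤ t) :
    IsSeparable (t • E) := by
  obtain ⟨-, r, F, hF, rfl⟩ := hE
  obtain ⟨k⟩ := ‹Nonempty P›
  have := isSeparable_sum_tensorOp (fun i p => (if p = k then t else 1) • F i p) fun i p =>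
    (hF i p).smul (by split_ifs <;> simp [ht])
  convert this using 1
  rw [Finset.smul_sum]
  refine Finset.sum_congr rfl fun i _ => ?_
  ext x y
  simp only [tensorOp, Matrix.smul_apply, Matrix.of_apply, Complex.real_smul,
    Finset.prod_mul_distrib, ← Complex.ofReal_prod, Finset.prod_ite_eq', Finset.mem_univ, if_true]

theorem IsSeparable.conj {κ : P → Type} [∀ p, Fintype (κ p)] {E : Op κ} (hE : IsSeparable E)
    (A : ∀ p, Matrix (κ p) (ι p) ℂ) : IsSeparable ((tensorOp A)ᴴ * E * tensorOp A) := by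
  obtain ⟨-, r, F, hF, rfl⟩ := hE
  have := isSeparable_sum_tensorOp (fun i p => (A p)ᴴ * F i p * A p) fun i p =>
    (hF i p).conjTranspose_mul_mul_same (A p)
  convert this using 1
  simp_rw [Matrix.mul_sum, Matrix.sum_mul, tensorOp_conjTranspose, tensorOp_mul]

/-- The identity is an order unit of the cone of separable operators. -/
theorem IsSeparable.exists_smul_one_sub [∀ p, DecidableEq (ι p)] {E : Op ι}
    (hE : IsSeparable E) : ∃ t : ℝ, IsSeparable (t • (1 : Op ι) - E) := by
  obtain ⟨-, r, F, hF, rfl⟩ := hE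
  have key : ∀ i, ∃ t : ℝ, IsSeparable (t • (1 : Op ι) - tensorOp (F i)) := by
    intro i
    choose t ht using fun p => posSemidef_smul_one_sub (hF i p)
    let G : Bool → ∀ p, Matrix (ι p) (ι p) ℂ := fun b p =>
      if b then F i p else t p • (1 : Matrix (ι p) (ι p) ℂ) - F i p
    have hG : ∀ b p, (G b p).PosSemidef := fun b p => by
      cases b
      · exact ht p
      · exact hF i p
    -- Expand the tensor product of `t p • 1 = F i p + (t p • 1 - F i p)`. The all-`true` term is
    -- `tensorOp (F i)`, and the other terms are separable.
    have hsum : (∏ p, t p) • (1 : Op ι) = ∑ β : P → Bool, tensorOp fun p => G (β p) p := by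
      rw [← tensorOp_one]
      ext x y
      simp only [tensorOp, Matrix.smul_apply, Matrix.of_apply, Matrix.sum_apply]
      rw [← Fintype.prod_sum (fun p b => G b p (x p) (y p))]
      simp [G, Finset.prod_mul_distrib]
    refine ⟨∏ p, t p, ?_⟩
    rw [hsum, Fintype.sum_eq_add_sum_subtype_ne _ (fun _ => true)]
    simp only [G, if_true, add_sub_cancel_left]
    exact isSeparable_sum_tensorOp _ fun β p => hG (β.1 p) p
  choose t ht using key
  refine ⟨∑ i, t i, ?_⟩
  rw [Finset.sum_smul, ← Finset.sum_sub_distrib]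
  exact IsSeparable.sum ht

theorem trace_smul_re {a : Type} [Fintype a] (t : ℝ) (X : Matrix a a ℂ) :
    (t • X).trace.re = t * X.trace.re := by
  rw [Matrix.trace_smul, Complex.smul_re, smul_eq_mul]

/-- Rescaling removes the normalization of the state; a positive semidefinite operator of trace zero
vanishes. -/
theorem IsBlockPositive.re_trace_mul_nonneg [Nonempty P] {E σ : Op ι} (hE : IsBlockPositive E)
    (hσ : IsSeparable σ) : 0 ≤ (E * σ).trace.re := by
  classical
  have h0 := hσ.1.trace_nonneg
  rw [Complex.nonneg_iff] at h0
  have htr : σ.trace = (σ.trace.re : ℂ) := Complex.ext rfl h0.2.symm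
  rcases h0.1.eq_or_lt with h | h
  · have : σ = 0 := hσ.1.trace_eq_zero_iff.1 (by rw [htr, ← h]; rfl)
    simp [this]
  · have := hE.2 (σ.trace.re⁻¹ • σ) (hσ.smul (inv_nonneg.2 h.le)) (by
      rw [Matrix.trace_smul, htr, Complex.ofReal_re, Complex.real_smul, ← Complex.ofReal_mul,
        inv_mul_cancel₀ h.ne']
      rfl)
    rw [Matrix.mul_smul, trace_smul_re] at this
    exact (mul_nonneg_iff_of_pos_left (inv_pos.2 h)).1 this

end Separable

/-! ### LOCC measurements are separable -/

section Locc

variable {P : Type} [Fintype P] [DecidableEq P] {ι : P → Type} [∀ p, Fintype (ι p)]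
  [∀ p, DecidableEq (ι p)] {o : Type} [DecidableEq o]

theorem RealizedByLOCC.isSeparable {M : o → Op ι} (hM : RealizedByLOCC ι M) (b : o) :
    IsSeparable (M b) := by
  induction hM with
  | announce ι a =>
    dsimp only
    split_ifs
    · exact isSeparable_one
    · exact isSeparable_zero
  | round ι k r κ A hk hp N hN ih => exact IsSeparable.sum fun j => (ih j).conj (A j)

theorem RealizedByLOCC.sum_eq_one [Fintype o] {M : o → Op ι} (hM : RealizedByLOCC ι M) :
    ∑ b, M b = 1 := by
  induction hM with
  | announce ι a => simp
  | round ι k r κ A hk hp N hN ih =>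
    rw [Finset.sum_comm]
    simp_rw [← Matrix.sum_mul, ← Matrix.mul_sum, ih, Matrix.mul_one, tensorOp_conjTranspose,
      tensorOp_mul]
    have hA : ∀ j, (fun p => (A j p)ᴴ * A j p) =
        Function.update (fun p => (1 : Matrix (ι p) (ι p) ℂ)) k ((A j k)ᴴ * A j k) := by
      intro j
      ext1 p
      rcases eq_or_ne p k with rfl | h
      · simp
      · rw [Function.update_of_ne h, hp j p h]
    -- Only the factor of the acting party depends on `j`; isolating it lets the sum over `j` pass
    -- to that factor.
    have hupd : ∀ B : Matrix (ι k) (ι k) ℂ, ∀ x y : ∀ p, ι p,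
        tensorOp (Function.update (fun p => (1 : Matrix (ι p) (ι p) ℂ)) k B) x y =
          B (x k) (y k) * ∏ p ∈ Finset.univ.erase k, (1 : Matrix (ι p) (ι p) ℂ) (x p) (y p) := by
      intro B x y
      rw [tensorOp, Matrix.of_apply, ← Finset.mul_prod_erase _ _ (Finset.mem_univ k),
        Function.update_self]
      congr 1
      refine Finset.prod_congr rfl fun p hp => ?_
      rw [Function.update_of_ne (Finset.ne_of_mem_erase hp)]
    simp_rw [hA]
    rw [← tensorOp_one]
    ext x y
    rw [Matrix.sum_apply]
    simp_rw [hupd]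
    rw [← Finset.sum_mul, ← Matrix.sum_apply, hk, ← hupd, Function.update_eq_self]

theorem RealizedByLOCC.isLOCCMeasurement [Fintype o] {M : o → Op ι} (hM : RealizedByLOCC ι M) :
    IsLOCCMeasurement M :=
  ⟨⟨fun b => (hM.isSeparable b).1, hM.sum_eq_one⟩, hM⟩

theorem IsLOCCMeasurement.isSepMeasurement [Fintype o] {M : o → Op ι}
    (hM : IsLOCCMeasurement M) : IsSepMeasurement M :=
  ⟨hM.1, hM.2.isSeparable⟩

end Locc

/-! ### Strong and weak duality for separable discrimination -/

section Duality

variable {P : Type} [Fintype P] [DecidableEq P] {ι : P → Type} [∀ p, Fintype (ι p)]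
  {o : Type} [Fintype o]

theorem Ensemble.nonempty_outcome (E : Ensemble ι o) : Nonempty o := by
  by_contra h
  rw [not_nonempty_iff] at h
  simpa using E.η_sum

theorem Ensemble.nonempty_index (E : Ensemble ι o) : Nonempty (∀ p, ι p) := by
  obtain ⟨i⟩ := E.nonempty_outcome
  by_contra h
  rw [not_nonempty_iff] at h
  simpa [Matrix.trace] using E.ρ_trace i

theorem re_trace_mul_nonneg {a : Type} [Fintype a] {A B : Matrix a a ℂ} (hA : A.PosSemidef)
    (hB : B.PosSemidef) : 0 ≤ (A * B).trace.re := by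
  classical
  open scoped MatrixOrder in
  obtain ⟨C, rfl⟩ := CStarAlgebra.nonneg_iff_eq_star_mul_self.mp hB.nonneg
  have h := (hA.mul_mul_conjTranspose_same C).trace_nonneg
  rw [Matrix.mul_assoc, Matrix.trace_mul_comm, Matrix.mul_assoc] at h
  exact (Complex.nonneg_iff.1 h).1

theorem Ensemble.success_nonneg (E : Ensemble ι o) {M : o → Op ι}
    (hM : ∀ i, (M i).PosSemidef) : 0 ≤ E.success M :=
  Finset.sum_nonneg fun i _ => mul_nonneg (E.η_pos i).le (re_trace_mul_nonneg (E.ρ_psd i) (hM i))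

variable [∀ p, DecidableEq (ι p)]

/-- The dual problem of optimal separable discrimination is solvable, without duality gap. -/
theorem Ensemble.IsPSEP.exists_dual [Nonempty P] {E : Ensemble ι o} {s : ℝ} (hs : E.IsPSEP s) :
    ∃ H : Op ι, H.IsHermitian ∧ H.trace.re = s ∧
      ∀ i, IsBlockPositive (H - (E.η i : ℂ) • E.ρ i) := by
  have := E.nonempty_outcome
  have := E.nonempty_index
  let C : PointedCone ℝ (Op ι) :=
    { carrier := {X | IsSeparable X}
      zero_mem' := isSeparable_zero
      add_mem' := fun hx hy => IsSeparable.add hx hy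
      smul_mem' := fun t _ hx => IsSeparable.smul hx t.2 }
  let T : Op ι →ₗ[ℝ] ℝ := Complex.reLm ∘ₗ (Matrix.traceLinearMap (∀ p, ι p) ℝ ℂ)
  let φ : o → Op ι →ₗ[ℝ] ℝ := fun i => E.η i • (T ∘ₗ LinearMap.mulLeft ℝ (E.ρ i))
  have hφ : ∀ i X, φ i X = E.η i * (E.ρ i * X).trace.re := fun i X => rfl
  have hT1 : T 1 = Fintype.card (∀ p, ι p) := by
    change (1 : Op ι).trace.re = _
    rw [Matrix.trace_one, Complex.natCast_re]
  have hcard : (0 : ℝ) < Fintype.card (∀ p, ι p) := by exact_mod_cast Fintype.card_pos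
  obtain ⟨h, h1, h2⟩ := exists_dual_functional C (e := 1)
    (fun X hX => IsSeparable.exists_smul_one_sub hX) isSeparable_one φ
    -- The trace of `1` is the dimension, so this multiple of the trace takes the value `s` there.
    ((s / Fintype.card (∀ p, ι p)) • T) (s := s)
    (by rw [LinearMap.smul_apply, hT1, smul_eq_mul, div_mul_cancel₀ _ hcard.ne'])
    (fun a M hM hsum => by
      have hM' : ∀ i, 0 ≤ (M i).trace := fun i => (hM i).1.trace_nonneg
      have hre : ∀ i, 0 ≤ T (M i) := fun i => (Complex.nonneg_iff.1 (hM' i)).1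
      have htr : ∑ i, T (M i) = a * Fintype.card (∀ p, ι p) := by
        rw [← map_sum, hsum, map_smul, hT1, smul_eq_mul]
      have ha : 0 ≤ a := by
        have : 0 ≤ a * Fintype.card (∀ p, ι p) := htr ▸ Finset.sum_nonneg fun i _ => hre i
        exact nonneg_of_mul_nonneg_left this hcard
      -- For `a = 0` the traces force every `M i = 0`; for `a > 0` the family rescales to a
      -- separable measurement, bounded by `s`.
      rcases ha.eq_or_lt with rfl | ha
      · rw [zero_mul, Finset.sum_eq_zero_iff_of_nonneg fun i _ => hre i] at htr
        rw [zero_mul]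
        refine (Finset.sum_eq_zero fun i hi => ?_).le
        have : M i = 0 := (hM i).1.trace_eq_zero_iff.1
          (Complex.ext (htr i hi) (Complex.nonneg_iff.1 (hM' i)).2.symm)
        rw [this, map_zero]
      · have hsep : ∀ i, IsSeparable (a⁻¹ • M i) := fun i =>
          IsSeparable.smul (hM i) (inv_nonneg.2 ha.le)
        have hle := hs.2 ⟨fun i => a⁻¹ • M i, ⟨⟨fun i => (hsep i).1, by
          rw [← Finset.smul_sum, hsum, inv_smul_smul₀ ha.ne']⟩, hsep⟩, rfl⟩
        have heq : E.success (fun i => a⁻¹ • M i) = a⁻¹ * ∑ i, φ i (M i) := by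
          rw [Finset.mul_sum]
          refine Finset.sum_congr rfl fun i _ => ?_
          rw [← smul_eq_mul a⁻¹, ← map_smul, hφ]
        rw [heq] at hle
        rwa [inv_mul_le_iff₀ ha] at hle)
  obtain ⟨H, hH, hHh⟩ := exists_isHermitian_re_trace h
  refine ⟨H, hH, ?_, fun i => ⟨?_, fun σ hσ _ => ?_⟩⟩
  · rw [← h1, hHh 1 Matrix.isHermitian_one, Matrix.mul_one]
  · refine hH.sub ?_
    rw [Matrix.IsHermitian, Matrix.conjTranspose_smul, (E.ρ_psd i).isHermitian.eq]
    simp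
  · have := h2 i σ hσ
    rw [hHh σ hσ.1.isHermitian, hφ] at this
    rw [Matrix.sub_mul, Matrix.smul_mul, Matrix.trace_sub, Matrix.trace_smul, Complex.sub_re,
      smul_eq_mul, Complex.re_ofReal_mul]
    linarith

/-- The gap between a dual value and the success probability of a measurement. -/
theorem Ensemble.sum_re_trace_gap (E : Ensemble ι o) {M : o → Op ι} (hM : ∑ i, M i = 1)
    (H : Op ι) :
    ∑ i, ((H - (E.η i : ℂ) • E.ρ i) * M i).trace.re = H.trace.re - E.success M := by
  simp_rw [Matrix.sub_mul, Matrix.smul_mul, Matrix.trace_sub, Matrix.trace_smul, Complex.sub_re,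
    smul_eq_mul, Complex.re_ofReal_mul, Finset.sum_sub_distrib]
  rw [← Complex.re_sum, ← Matrix.trace_sum, ← Matrix.mul_sum, hM, Matrix.mul_one]
  rfl

/-- Weak duality for separable discrimination. -/
theorem Ensemble.success_le_of_isBlockPositive [Nonempty P] (E : Ensemble ι o) {H : Op ι}
    (hH : ∀ i, IsBlockPositive (H - (E.η i : ℂ) • E.ρ i)) {M : o → Op ι}
    (hM : IsSepMeasurement M) : E.success M ≤ H.trace.re := by
  rw [← sub_nonneg, ← E.sum_re_trace_gap hM.1.2 H]
  exact Finset.sum_nonneg fun i _ => (hH i).re_trace_mul_nonneg (hM.2 i)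

theorem trace_mul_im_eq_zero {a : Type} [Fintype a] {A B : Matrix a a ℂ} (hA : A.IsHermitian)
    (hB : B.IsHermitian) : (A * B).trace.im = 0 := by
  have : star (A * B).trace = (A * B).trace := by
    rw [← Matrix.trace_conjTranspose, Matrix.conjTranspose_mul, hA.eq, hB.eq,
      Matrix.trace_mul_comm]
  exact Complex.conj_eq_iff_im.1 this

/-- Complementary slackness. -/
theorem Ensemble.trace_mul_eq_zero_of_success_eq [Nonempty P] (E : Ensemble ι o) {H : Op ι}
    (hH : ∀ i, IsBlockPositive (H - (E.η i : ℂ) • E.ρ i)) {M : o → Op ι}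
    (hM : IsSepMeasurement M) (hs : E.success M = H.trace.re) (i : o) :
    (M i * (H - (E.η i : ℂ) • E.ρ i)).trace = 0 := by
  have hsum := E.sum_re_trace_gap hM.1.2 H
  rw [hs, sub_self,
    Finset.sum_eq_zero_iff_of_nonneg fun i _ => (hH i).re_trace_mul_nonneg (hM.2 i)] at hsum
  rw [Matrix.trace_mul_comm]
  exact Complex.ext (hsum i (Finset.mem_univ i))
    (trace_mul_im_eq_zero (hH i).1 (hM.1.1 i).isHermitian)

/-- An announced guess succeeds with the prior probability of the guess. -/
theorem Ensemble.success_announce [DecidableEq o] (E : Ensemble ι o) (a : o) :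
    E.success (fun b => if b = a then 1 else 0) = E.η a := by
  unfold Ensemble.success
  rw [Finset.sum_eq_single a (fun b _ h => by simp [h]) (by simp)]
  simp [E.ρ_trace]

end Duality

/-! ### Success probabilities of sequences -/

section Sequence

variable {P S : Type} [Fintype P] [DecidableEq P] [Fintype S] [DecidableEq S]
  {ι : S → P → Type} [∀ l p, Fintype (ι l p)]

theorem stepTensor_mul (A B : ∀ l, Op (ι l)) :
    stepTensor A * stepTensor B = stepTensor fun l => A l * B l := by
  unfold stepTensor
  rw [← tensorOp_mul]
  exact Matrix.submatrix_mul_equiv (tensorOp A) (tensorOp B) _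
    (Equiv.piComm fun p l => ι l p) _

/-- The success probability of a sequence of independent measurements is the product of those of
the steps. -/
theorem seqEnsemble_success {o : S → Type} [∀ l, Fintype (o l)] (E : ∀ l, Ensemble (ι l) (o l))
    {M : ∀ l, o l → Op (ι l)} (hM : ∀ l i, (M l i).IsHermitian) :
    (seqEnsemble E).success (fun c => stepTensor fun l => M l (c l)) =
      ∏ l, (E l).success (M l) := by
  simp only [Ensemble.success]
  rw [Fintype.prod_sum]
  refine Finset.sum_congr rfl fun c _ => ?_
  -- Real parts multiply only because each of these traces is real.
  have htr : ∀ l, ((E l).ρ (c l) * M l (c l)).trace =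
      (((E l).ρ (c l) * M l (c l)).trace.re : ℂ) := fun l =>
    Complex.ext rfl (trace_mul_im_eq_zero ((E l).ρ_psd _).isHermitian (hM l _))
  simp only [seqEnsemble]
  rw [Finset.prod_mul_distrib, stepTensor_mul, stepTensor_trace, Finset.prod_congr rfl
    fun l _ => htr l, ← Complex.ofReal_prod, Complex.ofReal_re]

end Sequence

end MultiParty

/-! ### The characterization -/

open MultiParty in
theorem theorem4 {m L : ℕ} (hm : 1 ≤ m) (d : Fin L → Fin m → ℕ) (n : Fin L → ℕ)
    (E : ∀ l, MultiParty.Ensemble (fun k => Fin (d l k)) (Fin (n l))) :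
    (∃ (p : Fin L → ℝ) (q s : ℝ),
      (∀ l, (E l).IsPL (p l)) ∧
      (MultiParty.seqEnsemble E).IsPL q ∧
      (MultiParty.seqEnsemble E).IsPSEP s ∧
      ∏ l, p l = q ∧ q = s) ↔
    ∃ (M : ∀ l, Fin (n l) → MultiParty.Op (fun k => Fin (d l k)))
      (H : MultiParty.Op (fun k => ∀ l, Fin (d l k))),
      (∀ l, MultiParty.IsLOCCMeasurement (M l)) ∧
      H.IsHermitian ∧
      ∀ c : ∀ l, Fin (n l),
        MultiParty.IsBlockPositive
          (H - ((MultiParty.seqEnsemble E).η c : ℂ) • (MultiParty.seqEnsemble E).ρ c) ∧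
        (MultiParty.stepTensor (fun l => M l (c l)) *
          (H - ((MultiParty.seqEnsemble E).η c : ℂ) •
            (MultiParty.seqEnsemble E).ρ c)).trace = 0 := by
  have : Nonempty (Fin m) := ⟨⟨0, hm⟩⟩
  have hseq : ∀ {M : ∀ l, Fin (n l) → Op (fun k => Fin (d l k))},
      (∀ l, IsLOCCMeasurement (M l)) → IsLOCCMeasurement
        (fun c : ∀ l, Fin (n l) => stepTensor fun l => M l (c l)) := fun hM =>
    (RealizedByLOCC.stepTensor fun l => (hM l).2).isLOCCMeasurement
  have hsucc : ∀ {M : ∀ l, Fin (n l) → Op (fun k => Fin (d l k))},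
      (∀ l, IsLOCCMeasurement (M l)) →
      (seqEnsemble E).success (fun c => stepTensor fun l => M l (c l)) =
        ∏ l, (E l).success (M l) := fun hM =>
    seqEnsemble_success E fun l i => ((hM l).1.1 i).isHermitian
  constructor
  · rintro ⟨p, q, s, hp, -, hs, hpq, hqs⟩
    choose M hM hMp using fun l => (hp l).1
    obtain ⟨H, hH, htr, hbp⟩ := hs.exists_dual
    refine ⟨M, H, hM, hH, fun c => ⟨hbp c, ?_⟩⟩
    refine (seqEnsemble E).trace_mul_eq_zero_of_success_eq hbp (hseq hM).isSepMeasurement ?_ c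
    rw [hsucc hM, htr, ← hqs, ← hpq]
    exact Finset.prod_congr rfl fun l _ => hMp l
  · rintro ⟨M, H, hM, -, hH⟩
    have hval : (seqEnsemble E).success (fun c => stepTensor fun l => M l (c l)) = H.trace.re := by
      have h := (seqEnsemble E).sum_re_trace_gap (hseq hM).1.2 H
      rw [Finset.sum_eq_zero fun c _ => by rw [Matrix.trace_mul_comm, (hH c).2, Complex.zero_re]]
        at h
      exact (sub_eq_zero.1 h.symm).symm
    have hle : ∀ {N : (∀ l, Fin (n l)) → Op (fun k => ∀ l, Fin (d l k))}, IsSepMeasurement N →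
        (seqEnsemble E).success N ≤ H.trace.re :=
      (seqEnsemble E).success_le_of_isBlockPositive fun c => (hH c).1
    -- Always announcing a fixed `c` already succeeds with probability `η c > 0`. Positivity allows
    -- the cancellation below.
    have hpos : 0 < H.trace.re := by
      obtain ⟨c⟩ := (seqEnsemble E).nonempty_outcome
      refine lt_of_lt_of_le ((seqEnsemble E).η_pos c) ?_
      rw [← (seqEnsemble E).success_announce c]
      exact hle (RealizedByLOCC.announce _ c).isLOCCMeasurement.isSepMeasurement
    have hnonneg : ∀ l, 0 ≤ (E l).success (M l) := fun l =>
      (E l).success_nonneg (hM l).1.1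
    have hprod : ∏ l, (E l).success (M l) = H.trace.re := by rw [← hsucc hM, hval]
    refine ⟨fun l => (E l).success (M l), H.trace.re, H.trace.re, fun l => ⟨⟨M l, hM l, rfl⟩, ?_⟩,
      ⟨⟨_, hseq hM, hval⟩, ?_⟩, ⟨⟨_, (hseq hM).isSepMeasurement, hval⟩, ?_⟩, hprod, rfl⟩
    · rintro _ ⟨N, hN, rfl⟩
      -- Exchange step `l` for the competitor `N`, bound the new product by `Tr H`, and cancel the
      -- other factors.
      have hM' : ∀ l', IsLOCCMeasurement (Function.update M l N l') := by
        intro l'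
        rcases eq_or_ne l' l with rfl | h
        · rwa [Function.update_self]
        · rw [Function.update_of_ne h]
          exact hM l'
      have h := hle (hseq hM').isSepMeasurement
      rw [hsucc hM', ← hprod, ← Finset.mul_prod_erase _ _ (Finset.mem_univ l),
        ← Finset.mul_prod_erase _ _ (Finset.mem_univ l), Function.update_self,
        Finset.prod_congr rfl fun l' hl' => by
          rw [Function.update_of_ne (Finset.ne_of_mem_erase hl')]] at h
      refine le_of_mul_le_mul_right h ?_
      have h0 : 0 ≤ ∏ l' ∈ Finset.univ.erase l, (E l').success (M l') :=
        Finset.prod_nonneg fun l' _ => hnonneg l'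
      refine h0.lt_of_ne fun h0' => ?_
      rw [← Finset.mul_prod_erase _ _ (Finset.mem_univ l), ← h0', mul_zero] at hprod
      exact hpos.ne hprod
    · rintro _ ⟨N, hN, rfl⟩
      exact hle hN.isSepMeasurement
    · rintro _ ⟨N, hN, rfl⟩
      exact hle hN
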